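/- Let $A$ be a finite-dimensional Hopf algebra over a field $\Bbbk$, with comultiplication $\Delta(a)=a_{(1)}\otimes a_{(2)}$, counit $\varepsilon$ and antipode $S$, and let $\Lambda$ be a nonzero left integral of $A$, i.e. $a\Lambda=\varepsilon(a)\Lambda$ for all $a\in A$. Then there is a unique algebra homomorphism $\alpha:A\to\Bbbk$ with $\Lambda a=\alpha(a)\Lambda$ for all $a\in A$. Let $J=J^{(1)}\otimes J^{(2)}\in A\otimes A$ be a normalized twist, i.e. $J$ is invertible, with inverse $J^{-1}=J^{-(1)}\otimes J^{-(2)}$ (summations understood), $(\varepsilon\otimes \mathrm{id})(J)=(\mathrm{id}\otimes\varepsilon)(J)=1$ and $(\Delta\otimes \mathrm{id})(J)(J\otimes 1)=(\mathrm{id}\otimes\Delta)(J)(1\otimes J)$. Put $Q_J=S(J^{(1)})J^{(2)}$, which is invertible with $Q_J^{-1}=J^{-(1)}S(J^{-(2)})$, and let $A^J$ be the twisted Hopf algebra: the algebra $A$ with counit $\varepsilon$, comultiplication $\Delta^J(a)=J^{-1}\Delta(a)J$ and antipode $S^J(a)=Q_J^{-1}S(a)Q_J$. For $n\in\mathbb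 Z$ let $P_n$ and $P_n^J$ be the $n$-th Sweedler power maps of $A$ and $A^J$, i.e. the $n$-th convolution powers of the identity map (negative powers being powers of the convolution inverse, the antipode). Put $T=J^{-(1)}\alpha(J^{-(2)})$ and $R=\alpha(J^{-(1)})J^{-(2)}$. Then for every $n\in\mathbb Z$: 1. $P_n^J(\Lambda)=T\,P_n(\Lambda)$; 2. $P_n^J(\Lambda)=Q_J^{-1}P_n(\Lambda)S(R)Q_J$. If, moreover, $A$ is unimodular (its left integrals and its right integrals are the same elements), then $P_n^J(\Lambda)=P_n(\Lambda)$ for every $n\in\mathbb Z$. -/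

import Mathlib

open scoped TensorProduct

noncomputable section

namespace HopfTwist

universe u v

/-- `Λ` is a left integral of `A`: `a Λ = ε(a) Λ` for all `a`. -/
def IsLeftIntegral (k : Type u) {A : Type v} [Field k] [Ring A] [HopfAlgebra k A] (Λ : A) : Prop :=
  ∀ a : A, a * Λ = Coalgebra.counit (R := k) a • Λ

/-- `Λ` is a right integral of `A`: `Λ a = ε(a) Λ` for all `a`. -/
def IsRightIntegral (k : Type u) {A : Type v} [Field k] [Ring A] [HopfAlgebra k A] (Λ : A) : Prop :=
  ∀ a : A, Λ * a = Coalgebra.counit (R := k) a • Λ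

/-- `A` is unimodular: its left integrals and its right integrals are the same. -/
def IsUnimodular (k : Type u) (A : Type v) [Field k] [Ring A] [HopfAlgebra k A] : Prop :=
  ∀ Λ : A, IsLeftIntegral k Λ ↔ IsRightIntegral k Λ

/-- The identity map of `A` as an invertible element of the convolution algebra `Hom(A, A)`;
its convolution inverse is the antipode. -/
def convId (k : Type u) (A : Type v) [Field k] [Ring A] [HopfAlgebra k A] :
    (WithConv (A →ₗ[k] A))ˣ where
  val := WithConv.toConv LinearMap.id
  inv := WithConv.toConv (HopfAlgebra.antipode k)
  val_inv := LinearMap.id_mul_antipode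
  inv_val := LinearMap.antipode_mul_id

/-- The `n`-th Sweedler power map `P_n`: the `n`-th convolution power of the identity map. -/
def sweedlerPower (k : Type u) {A : Type v} [Field k] [Ring A] [HopfAlgebra k A] (n : ℤ) :
    A →ₗ[k] A :=
  ((convId k A ^ n : (WithConv (A →ₗ[k] A))ˣ) : WithConv (A →ₗ[k] A)).ofConv

variable {k : Type u} {A : Type v} [Field k] [Ring A] [HopfAlgebra k A]

/-- `J` is a normalized twist: `(ε ⊗ id)(J) = 1 = (id ⊗ ε)(J)` and
`(Δ ⊗ id)(J) (J ⊗ 1) = (id ⊗ Δ)(J) (1 ⊗ J)`. -/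
structure IsNormalizedTwist (J : (A ⊗[k] A)ˣ) : Prop where
  counit_left : Algebra.TensorProduct.lid k A
    (Algebra.TensorProduct.map (Bialgebra.counitAlgHom k A) (AlgHom.id k A) (J : A ⊗[k] A)) = 1
  counit_right : Algebra.TensorProduct.rid k k A
    (Algebra.TensorProduct.map (AlgHom.id k A) (Bialgebra.counitAlgHom k A) (J : A ⊗[k] A)) = 1
  cocycle : Algebra.TensorProduct.assoc k k k A A A
      (Algebra.TensorProduct.map (Bialgebra.comulAlgHom k A) (AlgHom.id k A) (J : A ⊗[k] A)
        * ((J : A ⊗[k] A) ⊗ₜ[k] (1 : A))) =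
    Algebra.TensorProduct.map (AlgHom.id k A) (Bialgebra.comulAlgHom k A) (J : A ⊗[k] A)
        * ((1 : A) ⊗ₜ[k] (J : A ⊗[k] A))

/-- `S(x) y`, extended linearly to `A ⊗ A`. -/
def antipodeMul : A ⊗[k] A →ₗ[k] A :=
  LinearMap.mul' k A ∘ₗ (HopfAlgebra.antipode k).rTensor A

/-- `x S(y)`, extended linearly to `A ⊗ A`. -/
def mulAntipode : A ⊗[k] A →ₗ[k] A :=
  LinearMap.mul' k A ∘ₗ (HopfAlgebra.antipode k).lTensor A

theorem antipodeMul_tmul (x y : A) :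
    antipodeMul (k := k) (x ⊗ₜ[k] y) = HopfAlgebra.antipode k x * y := by
  simp [antipodeMul]

theorem mulAntipode_tmul (x y : A) :
    mulAntipode (k := k) (x ⊗ₜ[k] y) = x * HopfAlgebra.antipode k y := by
  simp [mulAntipode]

theorem antipodeMul_comul_mul (x : A) (Z : A ⊗[k] A) :
    antipodeMul (k := k) ((Coalgebra.comul (R := k) x) * Z) =
      Coalgebra.counit (R := k) x • antipodeMul (k := k) Z := by
  induction Z with
  | zero => simp
  | add Z W hZ hW => rw [mul_add, map_add, hZ, hW, map_add, smul_add]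
  | tmul y z =>
    have h := HopfAlgebra.sum_antipode_mul_eq_smul (R := k) (Coalgebra.Repr.arbitrary k x)
    rw [← (Coalgebra.Repr.arbitrary k x).eq, Finset.sum_mul, map_sum]
    simp only [Algebra.TensorProduct.tmul_mul_tmul, antipodeMul_tmul,
      HopfAlgebra.antipode_mul_antidistrib]
    calc _ = HopfAlgebra.antipode k y * (∑ i ∈ (Coalgebra.Repr.arbitrary k x).index,
          HopfAlgebra.antipode k ((Coalgebra.Repr.arbitrary k x).left i) *
            (Coalgebra.Repr.arbitrary k x).right i) * z := by
          simp only [Finset.mul_sum, Finset.sum_mul, mul_assoc]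
      _ = _ := by rw [h]; simp

theorem mulAntipode_mul_comul (x : A) (Z : A ⊗[k] A) :
    mulAntipode (k := k) (Z * Coalgebra.comul (R := k) x) =
      Coalgebra.counit (R := k) x • mulAntipode (k := k) Z := by
  induction Z with
  | zero => simp
  | add Z W hZ hW => rw [add_mul, map_add, hZ, hW, map_add, smul_add]
  | tmul y z =>
    have h := HopfAlgebra.sum_mul_antipode_eq_smul (R := k) (Coalgebra.Repr.arbitrary k x)
    rw [← (Coalgebra.Repr.arbitrary k x).eq, Finset.mul_sum, map_sum]
    simp only [Algebra.TensorProduct.tmul_mul_tmul, mulAntipode_tmul,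
      HopfAlgebra.antipode_mul_antidistrib]
    calc _ = y * (∑ i ∈ (Coalgebra.Repr.arbitrary k x).index,
          ((Coalgebra.Repr.arbitrary k x).left i) *
            HopfAlgebra.antipode k ((Coalgebra.Repr.arbitrary k x).right i)) *
              HopfAlgebra.antipode k z := by
          simp only [Finset.mul_sum, Finset.sum_mul, mul_assoc]
      _ = _ := by rw [h]; simp

theorem mulAntipode_mul_tmul (X : A ⊗[k] A) (y z : A) :
    mulAntipode (k := k) (y ⊗ₜ[k] z * X) =
      y * mulAntipode (k := k) X * HopfAlgebra.antipode k z := by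
  induction X with
  | zero => simp
  | add Z W hZ hW => rw [mul_add, map_add, hZ, hW, map_add, mul_add, add_mul]
  | tmul a b => simp [mulAntipode_tmul, HopfAlgebra.antipode_mul_antidistrib, mul_assoc]

theorem antipodeMul_mul_tmul (X : A ⊗[k] A) (y z : A) :
    antipodeMul (k := k) (X * y ⊗ₜ[k] z) =
      HopfAlgebra.antipode k y * antipodeMul (k := k) X * z := by
  induction X with
  | zero => simp
  | add Z W hZ hW => rw [add_mul, map_add, hZ, hW, map_add, mul_add, add_mul]
  | tmul a b => simp [antipodeMul_tmul, HopfAlgebra.antipode_mul_antidistrib, mul_assoc]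

/-- `(Δ ⊗ id)`, with values in `A ⊗ (A ⊗ A)`. -/
def comulLeft : A ⊗[k] A →ₐ[k] A ⊗[k] (A ⊗[k] A) :=
  (Algebra.TensorProduct.assoc k k k A A A).toAlgHom.comp
    (Algebra.TensorProduct.map (Bialgebra.comulAlgHom k A) (AlgHom.id k A))

/-- `(id ⊗ Δ)`. -/
def comulRight : A ⊗[k] A →ₐ[k] A ⊗[k] (A ⊗[k] A) :=
  Algebra.TensorProduct.map (AlgHom.id k A) (Bialgebra.comulAlgHom k A)

/-- `x ↦ x ⊗ 1`, with values in `A ⊗ (A ⊗ A)`. -/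
def inclLeft : A ⊗[k] A →ₐ[k] A ⊗[k] (A ⊗[k] A) :=
  (Algebra.TensorProduct.assoc k k k A A A).toAlgHom.comp Algebra.TensorProduct.includeLeft

/-- `x ↦ 1 ⊗ x`. -/
def inclRight : A ⊗[k] A →ₐ[k] A ⊗[k] (A ⊗[k] A) :=
  Algebra.TensorProduct.includeRight

theorem IsNormalizedTwist.cocycle' {J : (A ⊗[k] A)ˣ} (hJ : IsNormalizedTwist J) :
    comulLeft (J : A ⊗[k] A) * inclLeft (J : A ⊗[k] A) =
      comulRight (J : A ⊗[k] A) * inclRight (J : A ⊗[k] A) := by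
  have := hJ.cocycle
  rw [map_mul] at this
  exact this

/-- `x ⊗ y ↦ ε(x) y`. -/
def counitLeft : A ⊗[k] A →ₐ[k] A :=
  (Algebra.TensorProduct.lid k A).toAlgHom.comp
    (Algebra.TensorProduct.map (Bialgebra.counitAlgHom k A) (AlgHom.id k A))

/-- `x ⊗ y ↦ ε(y) x`. -/
def counitRight : A ⊗[k] A →ₐ[k] A :=
  (Algebra.TensorProduct.rid k k A).toAlgHom.comp
    (Algebra.TensorProduct.map (AlgHom.id k A) (Bialgebra.counitAlgHom k A))

theorem counitLeft_tmul (x y : A) :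
    counitLeft (k := k) (x ⊗ₜ[k] y) = Coalgebra.counit (R := k) x • y := by
  simp [counitLeft]

theorem counitRight_tmul (x y : A) :
    counitRight (k := k) (x ⊗ₜ[k] y) = Coalgebra.counit (R := k) y • x := by
  simp [counitRight]

theorem comulLeft_tmul (x y : A) :
    comulLeft (k := k) (x ⊗ₜ[k] y) = ∑ i ∈ (Coalgebra.Repr.arbitrary k x).index,
      (Coalgebra.Repr.arbitrary k x).left i ⊗ₜ[k]
        ((Coalgebra.Repr.arbitrary k x).right i ⊗ₜ[k] y) := by
  have : comulLeft (k := k) (x ⊗ₜ[k] y) =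
      (Algebra.TensorProduct.assoc k k k A A A) (Coalgebra.comul (R := k) x ⊗ₜ[k] y) := by
    simp [comulLeft]
  rw [this, ← (Coalgebra.Repr.arbitrary k x).eq, TensorProduct.sum_tmul, map_sum]
  simp

theorem comulRight_tmul (x y : A) :
    comulRight (k := k) (x ⊗ₜ[k] y) = x ⊗ₜ[k] Coalgebra.comul (R := k) y := by
  simp [comulRight]

theorem contract_one (X Y : A ⊗[k] A) :
    antipodeMul (k := k) ((mulAntipode (k := k)).lTensor A (comulLeft X * comulRight Y)) =
      HopfAlgebra.antipode k (counitRight Y) * HopfAlgebra.antipode k (counitLeft X) := by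
  induction X with
  | zero => simp
  | add X X' hX hX' => simp only [map_add, add_mul, mul_add, hX, hX']
  | tmul x x' =>
    induction Y with
    | zero => simp
    | add Y Y' hY hY' => simp only [map_add, add_mul, mul_add, hY, hY']
    | tmul y y' =>
      rw [comulLeft_tmul, comulRight_tmul, Finset.sum_mul]
      simp only [map_sum, Algebra.TensorProduct.tmul_mul_tmul, LinearMap.lTensor_tmul,
        mulAntipode_mul_comul, mulAntipode_tmul, antipodeMul_tmul,
        HopfAlgebra.antipode_mul_antidistrib, counitRight_tmul, counitLeft_tmul, map_smul]
      have h := HopfAlgebra.sum_antipode_mul_eq_smul (R := k) (Coalgebra.Repr.arbitrary k x)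
      calc _ = Coalgebra.counit (R := k) y' • (HopfAlgebra.antipode k y *
            (∑ i ∈ (Coalgebra.Repr.arbitrary k x).index,
          HopfAlgebra.antipode k ((Coalgebra.Repr.arbitrary k x).left i) *
            (Coalgebra.Repr.arbitrary k x).right i) * HopfAlgebra.antipode k x') := by
            simp only [Finset.mul_sum, Finset.sum_mul, mul_assoc, Finset.smul_sum, mul_smul_comm]
        _ = _ := by rw [h]; simp [smul_comm (Coalgebra.counit (R := k) y')]

theorem contract_two (X Y : A ⊗[k] A) :
    LinearMap.mul' k A ((antipodeMul (k := k)).lTensor A (comulRight X * comulLeft Y)) =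
      counitRight X * counitLeft Y := by
  induction Y with
  | zero => simp
  | add X X' hX hX' => simp only [map_add, mul_add, hX, hX']
  | tmul x x' =>
    induction X with
    | zero => simp
    | add Y Y' hY hY' => simp only [map_add, add_mul, hY, hY']
    | tmul y y' =>
      rw [comulLeft_tmul, comulRight_tmul, Finset.mul_sum]
      simp only [map_sum, Algebra.TensorProduct.tmul_mul_tmul, LinearMap.lTensor_tmul,
        antipodeMul_comul_mul, antipodeMul_tmul, LinearMap.mul'_apply,
        counitRight_tmul, counitLeft_tmul]
      have h := HopfAlgebra.sum_mul_antipode_eq_smul (R := k) (Coalgebra.Repr.arbitrary k x)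
      calc _ = Coalgebra.counit (R := k) y' • (y *
            (∑ i ∈ (Coalgebra.Repr.arbitrary k x).index,
          ((Coalgebra.Repr.arbitrary k x).left i) *
            HopfAlgebra.antipode k ((Coalgebra.Repr.arbitrary k x).right i)) * x') := by
            simp only [Finset.mul_sum, Finset.sum_mul, mul_assoc, Finset.smul_sum, mul_smul_comm]
        _ = _ := by rw [h]; simp [smul_comm (Coalgebra.counit (R := k) y')]

theorem contract_one' (X Y : A ⊗[k] A) :
    antipodeMul (k := k) ((mulAntipode (k := k)).lTensor A (inclLeft X * inclRight Y)) =
      antipodeMul (k := k) X * mulAntipode (k := k) Y := by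
  induction X with
  | zero => simp
  | add X X' hX hX' => simp only [map_add, add_mul, hX, hX']
  | tmul x x' =>
    induction Y with
    | zero => simp
    | add Y Y' hY hY' => simp only [map_add, mul_add, hY, hY']
    | tmul y y' =>
      simp [inclLeft, inclRight, mulAntipode_tmul,
        antipodeMul_tmul, mul_assoc]

theorem contract_two' (X Y : A ⊗[k] A) :
    LinearMap.mul' k A ((antipodeMul (k := k)).lTensor A (inclRight X * inclLeft Y)) =
      mulAntipode (k := k) Y * antipodeMul (k := k) X := by
  induction X with
  | zero => simp
  | add X X' hX hX' => simp only [map_add, add_mul, mul_add, hX, hX']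
  | tmul x x' =>
    induction Y with
    | zero => simp
    | add Y Y' hY hY' => simp only [map_add, mul_add, add_mul, hY, hY']
    | tmul y y' =>
      simp [inclLeft, inclRight, mulAntipode_tmul,
        antipodeMul_tmul, mul_assoc, HopfAlgebra.antipode_mul_antidistrib]

theorem IsNormalizedTwist.counitLeft_inv {J : (A ⊗[k] A)ˣ} (hJ : IsNormalizedTwist J) :
    counitLeft ((J⁻¹ : (A ⊗[k] A)ˣ) : A ⊗[k] A) = 1 := by
  have h : counitLeft (J : A ⊗[k] A) = 1 := hJ.counit_left
  have h2 := congrArg (counitLeft (k := k) (A := A)) J.mul_inv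
  rwa [map_mul, h, one_mul, map_one] at h2

theorem IsNormalizedTwist.counitRight_inv {J : (A ⊗[k] A)ˣ} (hJ : IsNormalizedTwist J) :
    counitRight ((J⁻¹ : (A ⊗[k] A)ˣ) : A ⊗[k] A) = 1 := by
  have h : counitRight (J : A ⊗[k] A) = 1 := hJ.counit_right
  have h2 := congrArg (counitRight (k := k) (A := A)) J.mul_inv
  rwa [map_mul, h, one_mul, map_one] at h2

/-- The element `Q_J = S(J⁽¹⁾) J⁽²⁾`, with inverse `Q_J⁻¹ = J⁻⁽¹⁾ S(J⁻⁽²⁾)`. -/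
def twistQ (J : (A ⊗[k] A)ˣ) (hJ : IsNormalizedTwist J) : Aˣ where
  val := antipodeMul (k := k) (J : A ⊗[k] A)
  inv := mulAntipode (k := k) ((J⁻¹ : (A ⊗[k] A)ˣ) : A ⊗[k] A)
  val_inv := by
    have h : comulLeft ((J⁻¹ : (A ⊗[k] A)ˣ) : A ⊗[k] A) * comulRight (J : A ⊗[k] A) =
        inclLeft (J : A ⊗[k] A) * inclRight ((J⁻¹ : (A ⊗[k] A)ˣ) : A ⊗[k] A) := by
      have e1 : comulLeft ((J⁻¹ : (A ⊗[k] A)ˣ) : A ⊗[k] A) * comulLeft (J : A ⊗[k] A) = 1 := by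
        rw [← map_mul, J.inv_mul, map_one]
      have e2 : inclRight (J : A ⊗[k] A) * inclRight ((J⁻¹ : (A ⊗[k] A)ˣ) : A ⊗[k] A) = 1 := by
        rw [← map_mul, J.mul_inv, map_one]
      calc _ = comulLeft ((J⁻¹ : (A ⊗[k] A)ˣ) : A ⊗[k] A) *
            (comulRight (J : A ⊗[k] A) * inclRight (J : A ⊗[k] A)) *
              inclRight ((J⁻¹ : (A ⊗[k] A)ˣ) : A ⊗[k] A) := by
            rw [mul_assoc, mul_assoc, e2, mul_one]
        _ = _ := by rw [← hJ.cocycle', ← mul_assoc, e1, one_mul]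
    rw [← contract_one', ← h, contract_one, hJ.counitLeft_inv]
    rw [show counitRight (J : A ⊗[k] A) = 1 from hJ.counit_right]
    simp
  inv_val := by
    have h : comulRight ((J⁻¹ : (A ⊗[k] A)ˣ) : A ⊗[k] A) * comulLeft (J : A ⊗[k] A) =
        inclRight (J : A ⊗[k] A) * inclLeft ((J⁻¹ : (A ⊗[k] A)ˣ) : A ⊗[k] A) := by
      have e1 : comulRight ((J⁻¹ : (A ⊗[k] A)ˣ) : A ⊗[k] A) * comulRight (J : A ⊗[k] A) = 1 := by
        rw [← map_mul, J.inv_mul, map_one]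
      have e2 : inclLeft (J : A ⊗[k] A) * inclLeft ((J⁻¹ : (A ⊗[k] A)ˣ) : A ⊗[k] A) = 1 := by
        rw [← map_mul, J.mul_inv, map_one]
      calc _ = comulRight ((J⁻¹ : (A ⊗[k] A)ˣ) : A ⊗[k] A) *
            (comulLeft (J : A ⊗[k] A) * inclLeft (J : A ⊗[k] A)) *
              inclLeft ((J⁻¹ : (A ⊗[k] A)ˣ) : A ⊗[k] A) := by
            rw [mul_assoc, mul_assoc, e2, mul_one]
        _ = _ := by rw [hJ.cocycle', ← mul_assoc, e1, one_mul]
    rw [← contract_two', ← h, contract_two, hJ.counitRight_inv]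
    rw [show counitLeft (J : A ⊗[k] A) = 1 from hJ.counit_left]
    simp

/-- The twisted comultiplication `Δ^J(a) = J⁻¹ Δ(a) J`. -/
def twistComul (J : (A ⊗[k] A)ˣ) : A →ₐ[k] A ⊗[k] A :=
  AlgHom.ofLinearMap
    (LinearMap.mulLeft k ((J⁻¹ : (A ⊗[k] A)ˣ) : A ⊗[k] A) ∘ₗ
      LinearMap.mulRight k (J : A ⊗[k] A) ∘ₗ Coalgebra.comul)
    (by simp)
    (fun x y => by simp [mul_assoc])

theorem twistComul_apply (J : (A ⊗[k] A)ˣ) (a : A) :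
    twistComul J a =
      ((J⁻¹ : (A ⊗[k] A)ˣ) : A ⊗[k] A) * (Coalgebra.comul (R := k) a * (J : A ⊗[k] A)) := rfl

/-- The twisted antipode `S^J(a) = Q_J⁻¹ S(a) Q_J`. -/
def twistAntipode (J : (A ⊗[k] A)ˣ) (hJ : IsNormalizedTwist J) : A →ₗ[k] A :=
  LinearMap.mulLeft k (((twistQ J hJ)⁻¹ : Aˣ) : A) ∘ₗ
    LinearMap.mulRight k (twistQ J hJ : A) ∘ₗ HopfAlgebra.antipode k

theorem twistAntipode_apply (J : (A ⊗[k] A)ˣ) (hJ : IsNormalizedTwist J) (a : A) :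
    twistAntipode J hJ a =
      (((twistQ J hJ)⁻¹ : Aˣ) : A) * (HopfAlgebra.antipode k a * (twistQ J hJ : A)) := rfl

theorem twistComul_left (J : (A ⊗[k] A)ˣ) (X : A ⊗[k] A) :
    Algebra.TensorProduct.assoc k k k A A A
        (Algebra.TensorProduct.map (twistComul J) (AlgHom.id k A) X) =
      inclLeft ((J⁻¹ : (A ⊗[k] A)ˣ) : A ⊗[k] A) * (comulLeft X * inclLeft (J : A ⊗[k] A)) := by
  induction X with
  | zero => simp
  | add X Y hX hY => simp only [map_add, add_mul, mul_add, hX, hY]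
  | tmul x y =>
    simp only [inclLeft, comulLeft, AlgHom.comp_apply, AlgEquiv.toAlgHom_apply, ← map_mul]
    simp [twistComul_apply]

theorem twistComul_right (J : (A ⊗[k] A)ˣ) (X : A ⊗[k] A) :
    Algebra.TensorProduct.map (AlgHom.id k A) (twistComul J) X =
      inclRight ((J⁻¹ : (A ⊗[k] A)ˣ) : A ⊗[k] A) * (comulRight X * inclRight (J : A ⊗[k] A)) := by
  induction X with
  | zero => simp
  | add X Y hX hY => simp only [map_add, add_mul, mul_add, hX, hY]
  | tmul x y => simp [inclRight, comulRight, twistComul_apply]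

theorem comulLeft_comul (a : A) :
    comulLeft (Coalgebra.comul (R := k) a) = comulRight (Coalgebra.comul (R := k) a) :=
  Coalgebra.coassoc_apply a

theorem twist_coassoc (J : (A ⊗[k] A)ˣ) (hJ : IsNormalizedTwist J) (a : A) :
    Algebra.TensorProduct.assoc k k k A A A
        (Algebra.TensorProduct.map (twistComul J) (AlgHom.id k A) (twistComul J a)) =
      Algebra.TensorProduct.map (AlgHom.id k A) (twistComul J) (twistComul J a) := by
  rw [twistComul_left, twistComul_right, twistComul_apply]
  simp only [map_mul, comulLeft_comul]
  have e : inclLeft ((J⁻¹ : (A ⊗[k] A)ˣ) : A ⊗[k] A) *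
        comulLeft ((J⁻¹ : (A ⊗[k] A)ˣ) : A ⊗[k] A) =
      inclRight ((J⁻¹ : (A ⊗[k] A)ˣ) : A ⊗[k] A) *
        comulRight ((J⁻¹ : (A ⊗[k] A)ˣ) : A ⊗[k] A) := by
    have hu : Units.map (comulLeft (k := k) (A := A)).toMonoidHom J *
        Units.map (inclLeft (k := k) (A := A)).toMonoidHom J =
      Units.map (comulRight (k := k) (A := A)).toMonoidHom J *
        Units.map (inclRight (k := k) (A := A)).toMonoidHom J := Units.ext hJ.cocycle'
    have hv := congrArg (fun u : (A ⊗[k] (A ⊗[k] A))ˣ => ((u⁻¹ : (A ⊗[k] (A ⊗[k] A))ˣ) :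
      A ⊗[k] (A ⊗[k] A))) hu
    simp only [mul_inv_rev, Units.val_mul, ← map_inv] at hv
    exact hv
  calc _ = (inclLeft ((J⁻¹ : (A ⊗[k] A)ˣ) : A ⊗[k] A) *
        comulLeft ((J⁻¹ : (A ⊗[k] A)ˣ) : A ⊗[k] A)) * comulRight (Coalgebra.comul (R := k) a) *
        (comulLeft (J : A ⊗[k] A) * inclLeft (J : A ⊗[k] A)) := by simp only [mul_assoc]
    _ = _ := by rw [e, hJ.cocycle']; simp only [mul_assoc]

theorem counitLeft_comul (a : A) : counitLeft (Coalgebra.comul (R := k) a) = a := by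
  have h := Coalgebra.rTensor_counit_comul (R := k) a
  calc counitLeft (Coalgebra.comul (R := k) a)
      = TensorProduct.lid k A
          ((Coalgebra.counit (R := k)).rTensor A (Coalgebra.comul (R := k) a)) := rfl
    _ = a := by rw [h]; simp

theorem counitRight_comul (a : A) : counitRight (Coalgebra.comul (R := k) a) = a := by
  have h := Coalgebra.lTensor_counit_comul (R := k) a
  calc counitRight (Coalgebra.comul (R := k) a)
      = TensorProduct.rid k A
          ((Coalgebra.counit (R := k)).lTensor A (Coalgebra.comul (R := k) a)) := rfl
    _ = a := by rw [h]; simp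

theorem twist_counit_left (J : (A ⊗[k] A)ˣ) (hJ : IsNormalizedTwist J) (a : A) :
    counitLeft (twistComul J a) = a := by
  rw [twistComul_apply, map_mul, map_mul, hJ.counitLeft_inv, counitLeft_comul,
    show counitLeft (J : A ⊗[k] A) = 1 from hJ.counit_left]
  simp

theorem twist_counit_right (J : (A ⊗[k] A)ˣ) (hJ : IsNormalizedTwist J) (a : A) :
    counitRight (twistComul J a) = a := by
  rw [twistComul_apply, map_mul, map_mul, hJ.counitRight_inv, counitRight_comul,
    show counitRight (J : A ⊗[k] A) = 1 from hJ.counit_right]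
  simp

/-- The bialgebra `A^J`: the algebra `A` with its counit and the comultiplication `Δ^J`. -/
abbrev twistBialgebra (J : (A ⊗[k] A)ˣ) (hJ : IsNormalizedTwist J) : Bialgebra k A :=
  Bialgebra.ofAlgHom (twistComul J) (Bialgebra.counitAlgHom k A)
    (AlgHom.ext fun a => twist_coassoc J hJ a)
    (AlgHom.ext fun a => (AlgEquiv.eq_symm_apply _).2 (twist_counit_left J hJ a))
    (AlgHom.ext fun a => (AlgEquiv.eq_symm_apply _).2 (twist_counit_right J hJ a))

theorem twistAntipode_rTensor (J : (A ⊗[k] A)ˣ) (hJ : IsNormalizedTwist J) (X : A ⊗[k] A) :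
    LinearMap.mul' k A ((twistAntipode J hJ).rTensor A X) =
      (((twistQ J hJ)⁻¹ : Aˣ) : A) * antipodeMul (k := k) ((J : A ⊗[k] A) * X) := by
  induction X with
  | zero => simp
  | add X Y hX hY => simp only [map_add, mul_add, hX, hY]
  | tmul x y =>
    rw [antipodeMul_mul_tmul, LinearMap.rTensor_tmul, LinearMap.mul'_apply, twistAntipode_apply]
    simp only [mul_assoc]
    rfl

theorem twistAntipode_lTensor (J : (A ⊗[k] A)ˣ) (hJ : IsNormalizedTwist J) (X : A ⊗[k] A) :
    LinearMap.mul' k A ((twistAntipode J hJ).lTensor A X) =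
      mulAntipode (k := k) (X * ((J⁻¹ : (A ⊗[k] A)ˣ) : A ⊗[k] A)) * (twistQ J hJ : A) := by
  induction X with
  | zero => simp
  | add X Y hX hY => simp only [map_add, add_mul, hX, hY]
  | tmul x y =>
    rw [mulAntipode_mul_tmul, LinearMap.lTensor_tmul, LinearMap.mul'_apply, twistAntipode_apply]
    simp only [mul_assoc]
    rfl

/-- The twisted Hopf algebra `A^J`: the algebra `A` with its counit, the comultiplication `Δ^J` and
the antipode `S^J`. -/
abbrev twistHopfAlgebra (J : (A ⊗[k] A)ˣ) (hJ : IsNormalizedTwist J) : HopfAlgebra k A :=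
  { twistBialgebra J hJ with
    antipode := twistAntipode J hJ
    mul_antipode_rTensor_comul := LinearMap.ext fun a => by
      change LinearMap.mul' k A ((twistAntipode J hJ).rTensor A (twistComul J a)) =
        algebraMap k A (Coalgebra.counit (R := k) a)
      rw [twistAntipode_rTensor, twistComul_apply, ← mul_assoc, J.mul_inv, one_mul,
        antipodeMul_comul_mul, Algebra.algebraMap_eq_smul_one, mul_smul_comm]
      exact congrArg _ (twistQ J hJ).inv_mul
    mul_antipode_lTensor_comul := LinearMap.ext fun a => by
      change LinearMap.mul' k A ((twistAntipode J hJ).lTensor A (twistComul J a)) =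
        algebraMap k A (Coalgebra.counit (R := k) a)
      rw [twistAntipode_lTensor, twistComul_apply, mul_assoc, mul_assoc, J.mul_inv, mul_one,
        mulAntipode_mul_comul, Algebra.algebraMap_eq_smul_one, smul_mul_assoc]
      exact congrArg _ (twistQ J hJ).inv_mul }

/-- The `n`-th Sweedler power map `P_n^J` of the twisted Hopf algebra `A^J`. -/
def twistSweedlerPower (J : (A ⊗[k] A)ˣ) (hJ : IsNormalizedTwist J) (n : ℤ) : A →ₗ[k] A :=
  @sweedlerPower k A _ _ (twistHopfAlgebra J hJ) n

/-- `T = J⁻⁽¹⁾ α(J⁻⁽²⁾)`. -/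
def twistT (α : A →ₐ[k] k) (J : (A ⊗[k] A)ˣ) : A :=
  TensorProduct.rid k A (α.toLinearMap.lTensor A ((J⁻¹ : (A ⊗[k] A)ˣ) : A ⊗[k] A))

/-- `R = α(J⁻⁽¹⁾) J⁻⁽²⁾`. -/
def twistR (α : A →ₐ[k] k) (J : (A ⊗[k] A)ˣ) : A :=
  TensorProduct.lid k A (α.toLinearMap.rTensor A ((J⁻¹ : (A ⊗[k] A)ˣ) : A ⊗[k] A))

end HopfTwist

end

/-! The engine is a sliding identity: for `f` any convolution power of the identity, f(b₁ y) b₂ = b₁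
f(y b₂) for all b and y (`Slides`, `convPow_slides`). It is used twice.

With c = (Δ ⊗ id)(J)(J ⊗ 1) = (id ⊗ Δ)(J)(1 ⊗ J), it yields a closed formula Q_J P_n^J(x) = S(c₁)
P_n(c₂ x) c₃ for every x (`twistQ_mul_twistSweedlerPower`). The right side, multiplied by Q_J⁻¹, is
the convolution unit at n = 0. It also obeys the recursion for P_n^J: one form of c is suited to
P_{n+1}, the other to P_n, and sliding passes between them (`Slides.contract_eq`). At x = Λ the
middle leg acts by ε, so the formula collapses to Q_J P_n^J(Λ) = S(J⁽¹⁾) P_n(Λ) J⁽²⁾.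

Taking y = Λ in the sliding identity gives the commutation rules P_n(Λ) b = b₁ α(b₂) P_n(Λ) and S(b)
P_n(Λ) = P_n(Λ) α(b₁) S(b₂). Moving P_n(Λ) to the right of J⁽²⁾, or to the left of S(J⁽¹⁾), leaves
an expression in J and α alone, which the cocycle condition evaluates as Q_J T, respectively S(R)
Q_J.

The character α exists because Λa is again a left integral and left integrals are unique up to
scalars (`IsLeftIntegral.exists_eq_smul`). In the unimodular case α = ε, so T = 1. -/

noncomputable section

namespace HopfTwist

open Coalgebra WithConv HopfAlgebra

/-! ### Convolution algebra and the sliding identity -/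

section Convolution

variable {k A : Type*} [Field k] [Ring A] [HopfAlgebra k A]

/-- The element `b ↦ ε(b) c` of the convolution algebra `Hom(A, A)`. -/
def convConst (k : Type*) {A : Type*} [Field k] [Ring A] [HopfAlgebra k A] (c : A) :
    WithConv (A →ₗ[k] A) :=
  toConv ((Coalgebra.counit (R := k)).smulRight c)

/-- Together with `mul_convConst_apply`, this turns multiplication of values by fixed elements into
a convolution product, so that Sweedler-notation identities become identities in one ring. -/
theorem convConst_mul_apply (c : A) (f : WithConv (A →ₗ[k] A)) (b : A) :
    (convConst k c * f) b = c * f b := by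
  rw [(ℛ k b).convMul_apply]
  conv_rhs => rw [← sum_counit_smul (R := k) (ℛ k b), map_sum, Finset.mul_sum]
  refine Finset.sum_congr rfl fun i _ => ?_
  change (counit (R := k) _ • c) * _ = _
  rw [map_smul]
  simp

theorem sum_counit_right_smul (b : A) :
    ∑ i ∈ (ℛ k b).index, counit (R := k) ((ℛ k b).right i) • (ℛ k b).left i = b := by
  have := congrArg (TensorProduct.rid k A) (sum_tmul_counit_eq (R := k) (ℛ k b))
  rw [map_sum] at this
  simpa only [TensorProduct.rid_tmul, one_smul] using this

theorem mul_convConst_apply (c : A) (f : WithConv (A →ₗ[k] A)) (b : A) :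
    (f * convConst k c) b = f b * c := by
  rw [(ℛ k b).convMul_apply]
  conv_rhs => rw [← sum_counit_right_smul (k := k) b, map_sum, Finset.sum_mul]
  refine Finset.sum_congr rfl fun i _ => ?_
  change _ * (counit (R := k) _ • c) = _
  rw [map_smul]
  simp

/-- `b ↦ f(b y)`. -/
def precompMulRight (y : A) (f : WithConv (A →ₗ[k] A)) : WithConv (A →ₗ[k] A) :=
  toConv (f.ofConv ∘ₗ LinearMap.mulRight k y)

/-- `b ↦ f(y b)`. -/
def precompMulLeft (y : A) (f : WithConv (A →ₗ[k] A)) : WithConv (A →ₗ[k] A) :=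
  toConv (f.ofConv ∘ₗ LinearMap.mulLeft k y)

theorem precompMulRight_apply (y : A) (f : WithConv (A →ₗ[k] A)) (b : A) :
    precompMulRight y f b = f (b * y) := rfl

theorem precompMulLeft_apply (y : A) (f : WithConv (A →ₗ[k] A)) (b : A) :
    precompMulLeft y f b = f (y * b) := rfl

/-- Multiplicativity of Δ: the translating element is split along Δ(y) between the two factors. -/
theorem precompMulRight_mul (y : A) (f g : WithConv (A →ₗ[k] A)) :
    precompMulRight y (f * g) = ∑ i ∈ (ℛ k y).index,
      precompMulRight ((ℛ k y).left i) f * precompMulRight ((ℛ k y).right i) g := by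
  ext b
  change (f * g) (b * y) = _
  rw [((ℛ k b).mul (ℛ k y)).convMul_apply, ofConv_sum, LinearMap.sum_apply]
  simp only [Coalgebra.Repr.mul_index, Coalgebra.Repr.mul_left, Coalgebra.Repr.mul_right]
  rw [Finset.sum_product_right]
  exact Finset.sum_congr rfl fun i _ => ((ℛ k b).convMul_apply
    (precompMulRight ((ℛ k y).left i) f) (precompMulRight ((ℛ k y).right i) g)).symm

theorem precompMulLeft_mul (y : A) (f g : WithConv (A →ₗ[k] A)) :
    precompMulLeft y (f * g) = ∑ i ∈ (ℛ k y).index,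
      precompMulLeft ((ℛ k y).left i) f * precompMulLeft ((ℛ k y).right i) g := by
  ext b
  change (f * g) (y * b) = _
  rw [((ℛ k y).mul (ℛ k b)).convMul_apply, ofConv_sum, LinearMap.sum_apply]
  simp only [Coalgebra.Repr.mul_index, Coalgebra.Repr.mul_left, Coalgebra.Repr.mul_right]
  rw [Finset.sum_product]
  exact Finset.sum_congr rfl fun i _ => ((ℛ k b).convMul_apply
    (precompMulLeft ((ℛ k y).left i) f) (precompMulLeft ((ℛ k y).right i) g)).symm

/-- The identity of `A` in the convolution algebra. -/
abbrev idConv (k A : Type*) [Field k] [Ring A] [HopfAlgebra k A] : WithConv (A →ₗ[k] A) :=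
  toConv LinearMap.id

/-- The antipode of `A` in the convolution algebra. -/
abbrev antipodeConv (k A : Type*) [Field k] [Ring A] [HopfAlgebra k A] : WithConv (A →ₗ[k] A) :=
  toConv (antipode k)

theorem precompMulRight_id (y : A) :
    precompMulRight y (idConv k A) = idConv k A * convConst k y := by
  ext b
  exact (mul_convConst_apply (k := k) y (idConv k A) b).symm

theorem precompMulLeft_id (y : A) :
    precompMulLeft y (idConv k A) = convConst k y * idConv k A := by
  ext b
  exact (convConst_mul_apply (k := k) y (idConv k A) b).symm

/-- The constant changes sides, compared with `precompMulRight_id`, because S reverses products. -/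
theorem precompMulRight_antipode (y : A) :
    precompMulRight y (antipodeConv k A) = convConst k (antipode k y) * antipodeConv k A := by
  ext b
  exact (antipode_mul_antidistrib b y).trans
    (convConst_mul_apply (k := k) (antipode k y) (antipodeConv k A) b).symm

theorem precompMulLeft_antipode (y : A) :
    precompMulLeft y (antipodeConv k A) = antipodeConv k A * convConst k (antipode k y) := by
  ext b
  exact (antipode_mul_antidistrib y b).trans
    (mul_convConst_apply (k := k) (antipode k y) (antipodeConv k A) b).symm

theorem antipodeConv_mul_id : antipodeConv k A * idConv k A = 1 := LinearMap.antipode_mul_id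

theorem idConv_mul_antipode : idConv k A * antipodeConv k A = 1 := LinearMap.id_mul_antipode

/-- `f(b₁ y) b₂ = b₁ f(y b₂)` for all `b` and `y`. -/
def Slides (f : WithConv (A →ₗ[k] A)) : Prop :=
  ∀ y, precompMulRight y f * idConv k A = idConv k A * precompMulLeft y f

theorem Slides.one : Slides (1 : WithConv (A →ₗ[k] A)) := by
  intro y
  have h1 : precompMulRight y (1 : WithConv (A →ₗ[k] A)) = counit (R := k) y • 1 := by
    ext b
    change algebraMap k A (counit (R := k) (b * y)) = counit (R := k) y • algebraMap k A (counit b)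
    rw [Bialgebra.counit_mul, mul_comm, map_mul, Algebra.smul_def]
  have h2 : precompMulLeft y (1 : WithConv (A →ₗ[k] A)) = counit (R := k) y • 1 := by
    ext b
    change algebraMap k A (counit (R := k) (y * b)) = counit (R := k) y • algebraMap k A (counit b)
    rw [Bialgebra.counit_mul, map_mul, Algebra.smul_def]
  rw [h1, h2, smul_mul_assoc, mul_smul_comm, one_mul, mul_one]

/-- f(b₁ y₁) b₂ y₂ b₃ = b₁ f(y₁ b₂) y₂ b₃, by sliding `f` past b₂. -/
theorem Slides.mul_id {f : WithConv (A →ₗ[k] A)} (hf : Slides f) : Slides (f * idConv k A) := by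
  intro y
  rw [precompMulRight_mul, precompMulLeft_mul, Finset.sum_mul, Finset.mul_sum]
  refine Finset.sum_congr rfl fun i _ => ?_
  rw [precompMulRight_id, precompMulLeft_id, ← mul_assoc (precompMulRight _ _), hf]
  simp only [mul_assoc]

/-- In f(b₁ y₁) S(b₂ y₂) b₃ the factor S(b₂) b₃ cancels, leaving f(b y₁) S(y₂). On the other side,
sliding b₁ f(y₁ b₂) S(b₃) S(y₂) produces b₂ S(b₃), which cancels to the same element. -/
theorem Slides.mul_antipode {f : WithConv (A →ₗ[k] A)} (hf : Slides f) :
    Slides (f * antipodeConv k A) := by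
  intro y
  rw [precompMulRight_mul, precompMulLeft_mul, Finset.sum_mul, Finset.mul_sum]
  refine Finset.sum_congr rfl fun i _ => ?_
  rw [precompMulRight_antipode, precompMulLeft_antipode, mul_assoc, mul_assoc,
    antipodeConv_mul_id, mul_one, ← mul_assoc, ← mul_assoc, ← hf, mul_assoc (precompMulRight _ _),
    idConv_mul_antipode, mul_one]

/-- `S(b₁) (f * id)(b₂ y) = f(y₁ b) y₂`. -/
theorem Slides.antipode_mul {f : WithConv (A →ₗ[k] A)} (hf : Slides f) (y : A) :
    antipodeConv k A * precompMulRight y (f * idConv k A) = ∑ i ∈ (ℛ k y).index,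
      precompMulLeft ((ℛ k y).left i) f * convConst k ((ℛ k y).right i) := by
  rw [precompMulRight_mul, Finset.mul_sum]
  refine Finset.sum_congr rfl fun i _ => ?_
  rw [precompMulRight_id, ← mul_assoc (precompMulRight _ _), hf, ← mul_assoc, ← mul_assoc,
    antipodeConv_mul_id, one_mul]

/-- The `n`-th convolution power of the identity. -/
def convPow (k A : Type*) [Field k] [Ring A] [HopfAlgebra k A] (n : ℤ) : WithConv (A →ₗ[k] A) :=
  ((convId k A ^ n : (WithConv (A →ₗ[k] A))ˣ) : WithConv (A →ₗ[k] A))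

theorem convPow_add_one (n : ℤ) : convPow k A (n + 1) = convPow k A n * idConv k A := by
  rw [convPow, zpow_add_one]; rfl

theorem convPow_sub_one (n : ℤ) : convPow k A (n - 1) = convPow k A n * antipodeConv k A := by
  rw [convPow, zpow_sub_one]; rfl

theorem convPow_slides (n : ℤ) : Slides (convPow k A n) := by
  induction n with
  | zero => exact Slides.one
  | succ n ih => rw [convPow_add_one]; exact ih.mul_id
  | pred n ih => rw [convPow_sub_one]; exact ih.mul_antipode

/-- A sequence of maps that starts at the convolution unit and satisfies
`Φ (n + 1) = Φ n * id` consists of the Sweedler powers. -/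
theorem eq_sweedlerPower_of_succ (Φ : ℤ → A →ₗ[k] A)
    (h0 : ∀ x, Φ 0 x = algebraMap k A (counit (R := k) x))
    (hs : ∀ n x, Φ (n + 1) x = LinearMap.mul' k A ((Φ n).rTensor A (comul (R := k) x))) (n : ℤ) :
    Φ n = sweedlerPower k n := by
  have hs' : ∀ n, toConv (Φ (n + 1)) = toConv (Φ n) * idConv k A := fun n => by
    ext x; exact hs n x
  have key : ∀ n : ℤ, toConv (Φ n) = convPow k A n := by
    intro n
    induction n with
    | zero => ext x; exact h0 x
    | succ n ih => rw [hs', ih, convPow_add_one]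
    | pred n ih =>
      -- Going down, the recursion determines the earlier term, since the identity map is
      -- convolution-invertible with inverse S.
      have := hs' (-(n : ℤ) - 1)
      rw [sub_add_cancel, ih] at this
      rw [convPow_sub_one, this, mul_assoc, idConv_mul_antipode, mul_one]
  exact congrArg ofConv (key n)

end Convolution

/-! ### The closed formula for the twisted Sweedler powers -/

section Twist

variable {k A : Type*} [Field k] [Ring A] [HopfAlgebra k A]

/-- `y ⊗ z ↦ f(y) z`. -/
def evalMul (f : WithConv (A →ₗ[k] A)) : A ⊗[k] A →ₗ[k] A :=
  LinearMap.mul' k A ∘ₗ f.ofConv.rTensor A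

theorem evalMul_tmul (f : WithConv (A →ₗ[k] A)) (y z : A) : evalMul f (y ⊗ₜ[k] z) = f y * z := by
  simp [evalMul]

theorem evalMul_mul_tmul (f : WithConv (A →ₗ[k] A)) (W : A ⊗[k] A) (z : A) :
    evalMul f (W * (1 : A) ⊗ₜ[k] z) = evalMul f W * z := by
  induction W with
  | zero => simp
  | add W W' h h' => simp only [map_add, add_mul, h, h']
  | tmul a b => simp [evalMul_tmul, mul_assoc]

/-- `c₁ ⊗ c₂ ⊗ c₃ ↦ S(c₁) V(c₂ ⊗ c₃)`. -/
def contract (V : A ⊗[k] A →ₗ[k] A) : A ⊗[k] (A ⊗[k] A) →ₗ[k] A :=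
  antipodeMul (k := k) ∘ₗ V.lTensor A

theorem contract_tmul (V : A ⊗[k] A →ₗ[k] A) (x : A) (W : A ⊗[k] A) :
    contract V (x ⊗ₜ[k] W) = antipode k x * V W := by
  simp [contract, antipodeMul_tmul]

theorem inclLeft_tmul (x y : A) :
    inclLeft (k := k) (x ⊗ₜ[k] y) = x ⊗ₜ[k] (y ⊗ₜ[k] (1 : A)) := by
  simp [inclLeft]

theorem inclRight_apply (W : A ⊗[k] A) : inclRight (k := k) W = (1 : A) ⊗ₜ[k] W := by
  simp [inclRight]

/-- The last leg enters the contraction only as a right factor, so multiplying it on the right can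
be done before or after contracting. -/
theorem contract_evalMul_mul_tmul (f : WithConv (A →ₗ[k] A)) (c : A ⊗[k] (A ⊗[k] A)) (y z : A) :
    contract (evalMul f) (c * inclRight (y ⊗ₜ[k] (1 : A))) * z =
      contract (evalMul f) (c * inclRight (y ⊗ₜ[k] z)) := by
  induction c with
  | zero => simp
  | add c c' h h' => simp only [map_add, add_mul, h, h']
  | tmul a W =>
    have : y ⊗ₜ[k] z = y ⊗ₜ[k] (1 : A) * (1 : A) ⊗ₜ[k] z := by simp
    rw [inclRight_apply, inclRight_apply, Algebra.TensorProduct.tmul_mul_tmul,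
      Algebra.TensorProduct.tmul_mul_tmul, contract_tmul, contract_tmul, this, ← mul_assoc W,
      evalMul_mul_tmul, mul_assoc]

theorem Slides.evalMul_comul {f : WithConv (A →ₗ[k] A)} (hf : Slides f) (y b z : A) :
    evalMul f (comul (R := k) y * b ⊗ₜ[k] z) =
      (antipodeConv k A * precompMulRight y (f * idConv k A)) b * z := by
  rw [hf.antipode_mul, ← (ℛ k y).eq, Finset.sum_mul, map_sum, ofConv_sum, LinearMap.sum_apply,
    Finset.sum_mul]
  refine Finset.sum_congr rfl fun i _ => ?_
  rw [Algebra.TensorProduct.tmul_mul_tmul, evalMul_tmul, mul_convConst_apply,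
    precompMulLeft_apply, mul_assoc]

/-- The step from `f * id` to `f`. For X = a ⊗ a' and Y = b ⊗ b' the left side is S(b) S(a₁) (f *
id)(a₂ b' x) a'. By `Slides.antipode_mul` with y = b' x, the inner part is f((b' x)₁ a) (b' x)₂, and
Δ(b' x) = Δ(b') Δ(x) separates Y from x. -/
theorem Slides.contract_eq {f : WithConv (A →ₗ[k] A)} (hf : Slides f) (X Y : A ⊗[k] A) (x : A) :
    contract (evalMul (f * idConv k A)) (comulLeft X * inclLeft Y * inclRight (x ⊗ₜ[k] (1 : A))) =
      contract (evalMul f) (comulRight Y * inclRight (comul (R := k) x) * inclRight X) := by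
  induction X with
  | zero => simp
  | add X X' h h' => simp only [map_add, add_mul, mul_add, h, h']
  | tmul a a' =>
    induction Y with
    | zero => simp
    | add Y Y' h h' => simp only [map_add, add_mul, mul_add, h, h']
    | tmul b b' =>
      rw [comulLeft_tmul, comulRight_tmul, inclLeft_tmul, Finset.sum_mul, Finset.sum_mul, map_sum]
      simp only [inclRight_apply, Algebra.TensorProduct.tmul_mul_tmul, contract_tmul, mul_one]
      rw [← Bialgebra.comul_mul, hf.evalMul_comul, (ℛ k a).convMul_apply]
      simp only [evalMul_tmul, antipode_mul_antidistrib, Finset.mul_sum, Finset.sum_mul, mul_assoc,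
        precompMulRight_apply]

/-- `x ↦ S(c₁) f(c₂ x) c₃` for `c = (id ⊗ Δ)(J) (1 ⊗ J)`. -/
def twistContract (J : (A ⊗[k] A)ˣ) (f : WithConv (A →ₗ[k] A)) : A →ₗ[k] A :=
  contract (evalMul f) ∘ₗ
    LinearMap.mulLeft k (comulRight (J : A ⊗[k] A) * inclRight (J : A ⊗[k] A)) ∘ₗ
      (inclRight (k := k) (A := A)).toLinearMap ∘ₗ (TensorProduct.mk k A A).flip 1

theorem twistContract_apply (J : (A ⊗[k] A)ˣ) (f : WithConv (A →ₗ[k] A)) (x : A) :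
    twistContract J f x = contract (evalMul f)
      (comulRight (J : A ⊗[k] A) * inclRight (J : A ⊗[k] A) * inclRight (x ⊗ₜ[k] (1 : A))) := rfl

theorem twistContract_rTensor (J : (A ⊗[k] A)ˣ) (f : WithConv (A →ₗ[k] A)) (W : A ⊗[k] A) :
    LinearMap.mul' k A ((twistContract J f).rTensor A W) = contract (evalMul f)
      (comulRight (J : A ⊗[k] A) * inclRight (J : A ⊗[k] A) * inclRight W) := by
  induction W with
  | zero => simp
  | add W W' h h' => simp only [map_add, mul_add, h, h']
  | tmul y z =>
    rw [LinearMap.rTensor_tmul, LinearMap.mul'_apply, twistContract_apply,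
      contract_evalMul_mul_tmul]

/-- The recursion with respect to Δ^J. The cocycle condition puts c in the form that
`Slides.contract_eq` needs; on the other side, the factor 1 ⊗ J of c cancels the J⁻¹ in Δ^J(x). -/
theorem twistContract_succ {J : (A ⊗[k] A)ˣ} (hJ : IsNormalizedTwist J)
    {f : WithConv (A →ₗ[k] A)} (hf : Slides f) (x : A) :
    twistContract J (f * idConv k A) x =
      LinearMap.mul' k A ((twistContract J f).rTensor A (twistComul J x)) := by
  have e : inclRight (J : A ⊗[k] A) * inclRight ((J⁻¹ : (A ⊗[k] A)ˣ) : A ⊗[k] A) = 1 := by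
    rw [← map_mul, J.mul_inv, map_one]
  rw [twistContract_rTensor, twistContract_apply, ← hJ.cocycle', hf.contract_eq, hJ.cocycle',
    twistComul_apply, map_mul (inclRight (k := k) (A := A)),
    map_mul (inclRight (k := k) (A := A))]
  congr 1
  calc _ = comulRight (J : A ⊗[k] A) * (inclRight (J : A ⊗[k] A) *
        inclRight ((J⁻¹ : (A ⊗[k] A)ˣ) : A ⊗[k] A)) * inclRight (comul (R := k) x) *
          inclRight (J : A ⊗[k] A) := by rw [e, mul_one]
    _ = _ := by simp only [mul_assoc]

/-- If `f(y) = ε(y) c` at all multiples `y` of `x`, only `J` itself contributes. -/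
theorem contract_evalMul_of_forall_mul (f : WithConv (A →ₗ[k] A)) {x : A} {c : A}
    (hx : ∀ y, f (y * x) = counit (R := k) y • c) (X Y : A ⊗[k] A) :
    contract (evalMul f) (comulRight X * inclRight Y * inclRight (x ⊗ₜ[k] (1 : A))) =
      antipodeMul (k := k) ((LinearMap.mulLeft k c).lTensor A X *
        (1 : A) ⊗ₜ[k] counitLeft (k := k) Y) := by
  induction X with
  | zero => simp
  | add X X' h h' => simp only [map_add, add_mul, h, h']
  | tmul a a' =>
    induction Y with
    | zero => simp
    | add Y Y' h h' =>
      simp only [map_add, add_mul, mul_add, h, h', TensorProduct.tmul_add]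
    | tmul b b' =>
      rw [comulRight_tmul, ← (ℛ k a').eq, TensorProduct.tmul_sum, Finset.sum_mul, Finset.sum_mul,
        map_sum]
      simp only [inclRight_apply, Algebra.TensorProduct.tmul_mul_tmul, contract_tmul, mul_one,
        evalMul_tmul, hx, LinearMap.lTensor_tmul, counitLeft_tmul, antipodeMul_tmul,
        LinearMap.mulLeft_apply, Bialgebra.counit_mul]
      conv_rhs => rw [← sum_counit_smul (R := k) (ℛ k a')]
      simp only [Finset.mul_sum, Finset.sum_mul, Finset.smul_sum, mul_smul_comm, smul_mul_assoc,
        smul_smul, mul_assoc, mul_comm (counit (R := k) b)]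

theorem twistContract_of_forall_mul {J : (A ⊗[k] A)ˣ} (hJ : IsNormalizedTwist J)
    (f : WithConv (A →ₗ[k] A)) {x c : A} (hx : ∀ y, f (y * x) = counit (R := k) y • c) :
    twistContract J f x =
      antipodeMul (k := k) ((LinearMap.mulLeft k c).lTensor A (J : A ⊗[k] A)) := by
  rw [twistContract_apply, contract_evalMul_of_forall_mul f hx,
    show counitLeft (J : A ⊗[k] A) = 1 from hJ.counit_left, ← Algebra.TensorProduct.one_def,
    mul_one]

/-- `Q_J P_n^J(x) = S(c₁) P_n(c₂ x) c₃` for `c = (id ⊗ Δ)(J) (1 ⊗ J)`. -/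
theorem twistQ_mul_twistSweedlerPower {J : (A ⊗[k] A)ˣ} (hJ : IsNormalizedTwist J) (n : ℤ)
    (x : A) :
    (twistQ J hJ : A) * twistSweedlerPower J hJ n x = twistContract J (convPow k A n) x := by
  -- The characterization of Sweedler powers is applied in A^J, not in A; the powers inside the
  -- contraction are those of A.
  have key := @eq_sweedlerPower_of_succ k A _ _ (twistHopfAlgebra J hJ)
    (fun n => LinearMap.mulLeft k (((twistQ J hJ)⁻¹ : Aˣ) : A) ∘ₗ
      twistContract J (convPow k A n)) ?_ ?_ n
  · rw [twistSweedlerPower, ← key]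
    exact (twistQ J hJ).mul_inv_cancel_left _
  · intro x
    change (((twistQ J hJ)⁻¹ : Aˣ) : A) * twistContract J (convPow k A 0) x =
      algebraMap k A (counit (R := k) x)
    -- Since P_0 is the counit, every x meets the hypothesis of the collapse lemma, with constant
    -- ε(x)1; the contraction is then ε(x) Q_J.
    have h : ∀ y, convPow k A 0 (y * x) =
        counit (R := k) y • (algebraMap k A (counit (R := k) x)) := fun y => by
      change algebraMap k A (counit (R := k) (y * x)) = _
      rw [Bialgebra.counit_mul, map_mul, Algebra.smul_def]
    rw [twistContract_of_forall_mul hJ _ h]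
    have h2 : LinearMap.mulLeft k (algebraMap k A (counit (R := k) x)) =
        counit (R := k) x • LinearMap.id := by
      ext y; simp [Algebra.smul_def]
    rw [h2, LinearMap.lTensor_smul, LinearMap.lTensor_id, LinearMap.smul_apply, map_smul,
      mul_smul_comm, Algebra.algebraMap_eq_smul_one]
    exact congrArg _ (twistQ J hJ).inv_mul
  · intro n x
    change (((twistQ J hJ)⁻¹ : Aˣ) : A) * twistContract J (convPow k A (n + 1)) x =
      LinearMap.mul' k A ((LinearMap.mulLeft k (((twistQ J hJ)⁻¹ : Aˣ) : A) ∘ₗ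
        twistContract J (convPow k A n)).rTensor A (twistComul J x))
    rw [convPow_add_one, twistContract_succ hJ (convPow_slides n)]
    generalize twistComul J x = W
    induction W with
    | zero => simp
    | add W W' h h' => simp only [map_add, mul_add, h, h']
    | tmul y z => simp [mul_assoc]

end Twist

/-! ### Commutation rules at the integral and evaluation by T and R -/

section Integral

variable {k A : Type*} [Field k] [Ring A] [HopfAlgebra k A]

/-- An algebra homomorphism `A → k` in the convolution algebra `Hom(A, A)`. -/
def charConv (α : A →ₐ[k] k) : WithConv (A →ₗ[k] A) :=
  toConv (α.toLinearMap.smulRight 1)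

theorem charConv_mul_convConst (α : A →ₐ[k] k) (c b : A) :
    (charConv α * convConst k c) b = α b • c := by
  rw [mul_convConst_apply]
  change (α b • (1 : A)) * c = _
  simp

theorem convConst_mul_charConv (α : A →ₐ[k] k) (c b : A) :
    (convConst k c * charConv α) b = α b • c := by
  rw [convConst_mul_apply]
  change c * (α b • (1 : A)) = _
  simp

/-- The sliding identity at y = Λ, where f(b₁ Λ) = ε(b₁) f(Λ) and f(Λ b₂) = α(b₂) f(Λ). In elements:
f(Λ) b = b₁ α(b₂) f(Λ). -/
theorem Slides.convConst_mul_id {f : WithConv (A →ₗ[k] A)} (hf : Slides f) {Λ : A}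
    (hΛ : IsLeftIntegral k Λ) {α : A →ₐ[k] k} (hα : ∀ a, Λ * a = α a • Λ) :
    convConst k (f Λ) * idConv k A = idConv k A * charConv α * convConst k (f Λ) := by
  have h := hf Λ
  have h1 : precompMulRight Λ f = convConst k (f Λ) := by
    ext b
    change f (b * Λ) = counit (R := k) b • f Λ
    rw [hΛ, map_smul]
  have h2 : precompMulLeft Λ f = charConv α * convConst k (f Λ) := by
    ext b
    refine Eq.trans ?_ (charConv_mul_convConst α (f Λ) b).symm
    change f (Λ * b) = _
    rw [hα, map_smul]
  rw [← h1, h, h2, h1, mul_assoc]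

theorem charConv_mul_convConst_comm (α : A →ₐ[k] k) (c : A) :
    charConv α * convConst k c = convConst k c * charConv α := by
  ext b
  exact (charConv_mul_convConst α c b).trans (convConst_mul_charConv α c b).symm

/-- Convolving the previous rule with S on both sides gives S(b) f(Λ) = f(Λ) α(b₁) S(b₂). -/
theorem Slides.antipode_mul_convConst {f : WithConv (A →ₗ[k] A)} (hf : Slides f) {Λ : A}
    (hΛ : IsLeftIntegral k Λ) {α : A →ₐ[k] k} (hα : ∀ a, Λ * a = α a • Λ) :
    antipodeConv k A * convConst k (f Λ) =
      convConst k (f Λ) * (charConv α * antipodeConv k A) := by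
  calc antipodeConv k A * convConst k (f Λ)
      = antipodeConv k A * (convConst k (f Λ) * idConv k A) * antipodeConv k A := by
        rw [mul_assoc, mul_assoc, idConv_mul_antipode, mul_one]
    _ = _ := by
        rw [hf.convConst_mul_id hΛ hα, mul_assoc (idConv k A), ← mul_assoc, ← mul_assoc,
          antipodeConv_mul_id, one_mul, charConv_mul_convConst_comm, mul_assoc]

/-- `y ⊗ z ↦ α(z) y`. -/
def charRight (α : A →ₐ[k] k) : A ⊗[k] A →ₗ[k] A :=
  (TensorProduct.rid k A).toLinearMap ∘ₗ α.toLinearMap.lTensor A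

theorem charRight_tmul (α : A →ₐ[k] k) (y z : A) :
    charRight α (y ⊗ₜ[k] z) = α z • y := by simp [charRight]

/-- `y ⊗ z ↦ α(y) z`. -/
def charLeft (α : A →ₐ[k] k) : A ⊗[k] A →ₗ[k] A :=
  (TensorProduct.lid k A).toLinearMap ∘ₗ α.toLinearMap.rTensor A

theorem charLeft_tmul (α : A →ₐ[k] k) (y z : A) :
    charLeft α (y ⊗ₜ[k] z) = α y • z := by simp [charLeft]

theorem charRight_comul (α : A →ₐ[k] k) (b : A) :
    charRight α (comul (R := k) b) = (idConv k A * charConv α) b := by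
  rw [(ℛ k b).convMul_apply, ← (ℛ k b).eq, map_sum]
  refine Finset.sum_congr rfl fun i _ => ?_
  rw [charRight_tmul]
  change _ = _ * (α _ • (1 : A))
  simp

/-- Applied to c₁ ⊗ c₂ ⊗ c₃, the contraction is S(c₁) c₂ α(c₃). The legs of Δ(X⁽¹⁾) meet as S(a₁) a₂
and reduce to a counit, while multiplicativity of α separates the last legs. -/
theorem contract_charRight (α : A →ₐ[k] k) (X Y Z : A ⊗[k] A) :
    contract (charRight α) (comulLeft X * inclLeft Y * inclRight Z) =
      α (counitLeft X) • (antipodeMul (k := k) Y * charRight α Z) := by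
  induction X with
  | zero => simp
  | add X X' h h' => simp only [map_add, add_mul, add_smul, h, h']
  | tmul a a' =>
    induction Y with
    | zero => simp
    | add Y Y' h h' => simp only [map_add, add_mul, mul_add, smul_add, h, h']
    | tmul b b' =>
      induction Z with
      | zero => simp
      | add Z Z' h h' => simp only [map_add, mul_add, smul_add, h, h']
      | tmul c c' =>
        rw [comulLeft_tmul, inclLeft_tmul, Finset.sum_mul, Finset.sum_mul, map_sum]
        simp only [inclRight_apply, Algebra.TensorProduct.tmul_mul_tmul, contract_tmul, mul_one,
          charRight_tmul, counitLeft_tmul, antipodeMul_tmul, antipode_mul_antidistrib, map_mul,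
          map_smul, smul_eq_mul]
        have h := sum_antipode_mul_eq_smul (R := k) (ℛ k a)
        calc _ = (α a' * α c') • (antipode k b * (∑ i ∈ (ℛ k a).index,
              antipode k ((ℛ k a).left i) * (ℛ k a).right i) * b' * c) := by
              simp only [Finset.mul_sum, Finset.sum_mul, mul_assoc, Finset.smul_sum, mul_smul_comm]
          _ = _ := by
              rw [h]
              simp only [mul_smul_comm, smul_mul_assoc, smul_smul, mul_one, mul_assoc]
              congr 1
              ring

/-- `c₁ ⊗ c₂ ⊗ c₃ ↦ α(c₁) S(c₂) c₃`. -/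
def charContract (α : A →ₐ[k] k) : A ⊗[k] (A ⊗[k] A) →ₗ[k] A :=
  (TensorProduct.lid k A).toLinearMap ∘ₗ TensorProduct.map α.toLinearMap (antipodeMul (k := k))

theorem charContract_tmul (α : A →ₐ[k] k) (x : A) (W : A ⊗[k] A) :
    charContract α (x ⊗ₜ[k] W) = α x • antipodeMul (k := k) W := by
  simp [charContract]

/-- The mirror image of `contract_charRight`: here Δ(X⁽²⁾) is absorbed by S(a₁) a₂, and the second
leg of Z comes out on the left under S. -/
theorem charContract_eq (α : A →ₐ[k] k) (X Y Z : A ⊗[k] A) :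
    charContract α (comulRight X * inclRight Y * inclLeft Z) =
      α (counitRight X) • (antipode k (charLeft α Z) * antipodeMul (k := k) Y) := by
  induction X with
  | zero => simp
  | add X X' h h' => simp only [map_add, add_mul, add_smul, h, h']
  | tmul a a' =>
    induction Z with
    | zero => simp
    | add Z Z' h h' => simp only [map_add, mul_add, add_mul, smul_add, h, h']
    | tmul c c' =>
      rw [comulRight_tmul, inclLeft_tmul, inclRight_apply]
      simp only [Algebra.TensorProduct.tmul_mul_tmul, charContract_tmul, mul_one]
      rw [mul_assoc, antipodeMul_comul_mul, antipodeMul_mul_tmul, charLeft_tmul, counitRight_tmul]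
      simp only [map_mul, map_smul, smul_eq_mul, smul_smul, mul_one, smul_mul_assoc]
      congr 1
      ring

theorem contract_charRight_comulRight (α : A →ₐ[k] k) (X : A ⊗[k] A) :
    contract (charRight α) (comulRight X) =
      antipodeMul (k := k) ((idConv k A * charConv α).ofConv.lTensor A X) := by
  induction X with
  | zero => simp
  | add X X' h h' => simp only [map_add, h, h']
  | tmul a a' =>
    rw [comulRight_tmul, contract_tmul, charRight_comul, LinearMap.lTensor_tmul, antipodeMul_tmul]

theorem charContract_comulLeft (α : A →ₐ[k] k) (X : A ⊗[k] A) :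
    charContract α (comulLeft X) =
      LinearMap.mul' k A ((charConv α * antipodeConv k A).ofConv.rTensor A X) := by
  induction X with
  | zero => simp
  | add X X' h h' => simp only [map_add, h, h']
  | tmul a a' =>
    rw [comulLeft_tmul, map_sum, LinearMap.rTensor_tmul, LinearMap.mul'_apply,
      (ℛ k a).convMul_apply, Finset.sum_mul]
    refine Finset.sum_congr rfl fun i _ => ?_
    rw [charContract_tmul, antipodeMul_tmul]
    change _ = (α _ • (1 : A)) * _ * _
    simp

/-- `S(J₁) (J₂)₁ α((J₂)₂) = Q_J T`. -/
theorem antipodeMul_id_mul_charConv {J : (A ⊗[k] A)ˣ} (hJ : IsNormalizedTwist J)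
    (α : A →ₐ[k] k) :
    antipodeMul (k := k) ((idConv k A * charConv α).ofConv.lTensor A (J : A ⊗[k] A)) =
      (twistQ J hJ : A) * twistT α J := by
  have e : inclRight (J : A ⊗[k] A) * inclRight ((J⁻¹ : (A ⊗[k] A)ˣ) : A ⊗[k] A) = 1 := by
    rw [← map_mul, J.mul_inv, map_one]
  have h : comulRight (J : A ⊗[k] A) = comulLeft (J : A ⊗[k] A) * inclLeft (J : A ⊗[k] A) *
      inclRight ((J⁻¹ : (A ⊗[k] A)ˣ) : A ⊗[k] A) := by
    rw [hJ.cocycle', mul_assoc, e, mul_one]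
  rw [← contract_charRight_comulRight, h, contract_charRight,
    show counitLeft (J : A ⊗[k] A) = 1 from hJ.counit_left, map_one, one_smul]
  rfl

/-- `α((J₁)₁) S((J₁)₂) J₂ = S(R) Q_J`. -/
theorem mul_charConv_mul_antipode {J : (A ⊗[k] A)ˣ} (hJ : IsNormalizedTwist J)
    (α : A →ₐ[k] k) :
    LinearMap.mul' k A ((charConv α * antipodeConv k A).ofConv.rTensor A (J : A ⊗[k] A)) =
      antipode k (twistR α J) * (twistQ J hJ : A) := by
  have e : inclLeft (J : A ⊗[k] A) * inclLeft ((J⁻¹ : (A ⊗[k] A)ˣ) : A ⊗[k] A) = 1 := by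
    rw [← map_mul, J.mul_inv, map_one]
  have h : comulLeft (J : A ⊗[k] A) = comulRight (J : A ⊗[k] A) * inclRight (J : A ⊗[k] A) *
      inclLeft ((J⁻¹ : (A ⊗[k] A)ˣ) : A ⊗[k] A) := by
    rw [← hJ.cocycle', mul_assoc, e, mul_one]
  rw [← charContract_comulLeft, h, charContract_eq,
    show counitRight (J : A ⊗[k] A) = 1 from hJ.counit_right, map_one, one_smul]
  rfl

/-- `Q_J P_n^J(Λ) = S(J₁) P_n(Λ) J₂`. -/
theorem twistQ_mul_twistSweedlerPower_integral {Λ : A} (hΛ : IsLeftIntegral k Λ)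
    {J : (A ⊗[k] A)ˣ} (hJ : IsNormalizedTwist J) (n : ℤ) :
    (twistQ J hJ : A) * twistSweedlerPower J hJ n Λ = antipodeMul (k := k)
      ((LinearMap.mulLeft k (sweedlerPower k n Λ)).lTensor A (J : A ⊗[k] A)) := by
  rw [twistQ_mul_twistSweedlerPower]
  refine twistContract_of_forall_mul hJ _ fun y => ?_
  rw [hΛ, map_smul]
  rfl

theorem twistSweedlerPower_integral_eq_twistT_mul {Λ : A} (hΛ : IsLeftIntegral k Λ)
    {α : A →ₐ[k] k} (hα : ∀ a, Λ * a = α a • Λ)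
    {J : (A ⊗[k] A)ˣ} (hJ : IsNormalizedTwist J) (n : ℤ) :
    twistSweedlerPower J hJ n Λ = twistT α J * sweedlerPower k n Λ := by
  rw [← (twistQ J hJ).mul_right_inj, twistQ_mul_twistSweedlerPower_integral hΛ, ← mul_assoc,
    ← antipodeMul_id_mul_charConv]
  have h : ∀ b, sweedlerPower k n Λ * b =
      (idConv k A * charConv α) b * sweedlerPower k n Λ := fun b => by
    have := congrArg (fun f : WithConv (A →ₗ[k] A) => f b)
      ((convPow_slides n).convConst_mul_id hΛ hα)
    rwa [convConst_mul_apply, mul_convConst_apply] at this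
  -- What remains is linear in J and holds for any tensor; the cocycle condition has already been
  -- spent in producing Q_J T.
  generalize (J : A ⊗[k] A) = X
  induction X with
  | zero => simp
  | add X Y hX hY => simp only [map_add, add_mul, hX, hY]
  | tmul a b =>
    rw [LinearMap.lTensor_tmul, LinearMap.lTensor_tmul, antipodeMul_tmul, antipodeMul_tmul,
      LinearMap.mulLeft_apply, h, mul_assoc]

theorem twistSweedlerPower_integral_eq_mul_twistR {Λ : A} (hΛ : IsLeftIntegral k Λ)
    {α : A →ₐ[k] k} (hα : ∀ a, Λ * a = α a • Λ)
    {J : (A ⊗[k] A)ˣ} (hJ : IsNormalizedTwist J) (n : ℤ) :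
    twistSweedlerPower J hJ n Λ = (((twistQ J hJ)⁻¹ : Aˣ) : A) * sweedlerPower k n Λ *
      antipode k (twistR α J) * (twistQ J hJ : A) := by
  rw [← (twistQ J hJ).mul_right_inj, twistQ_mul_twistSweedlerPower_integral hΛ, mul_assoc,
    mul_assoc, Units.mul_inv_cancel_left, ← mul_charConv_mul_antipode]
  have h : ∀ b, antipode k b * sweedlerPower k n Λ =
      sweedlerPower k n Λ * (charConv α * antipodeConv k A) b := fun b => by
    have := congrArg (fun f : WithConv (A →ₗ[k] A) => f b)
      ((convPow_slides n).antipode_mul_convConst hΛ hα)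
    rwa [convConst_mul_apply, mul_convConst_apply] at this
  generalize (J : A ⊗[k] A) = X
  induction X with
  | zero => simp
  | add X Y hX hY => simp only [map_add, mul_add, hX, hY]
  | tmul a b =>
    rw [LinearMap.lTensor_tmul, LinearMap.rTensor_tmul, antipodeMul_tmul, LinearMap.mul'_apply,
      LinearMap.mulLeft_apply, ← mul_assoc, h, mul_assoc]

end Integral

/-! ### Uniqueness of integrals and the distinguished character -/

section IntegralUniqueness

variable {k A : Type*} [Field k] [Ring A] [HopfAlgebra k A]

theorem antipodeMul_comul (x : A) :
    antipodeMul (k := k) (comul (R := k) x) = counit (R := k) x • (1 : A) := by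
  have := antipodeMul_comul_mul (k := k) x 1
  rw [mul_one] at this
  simp [this, Algebra.TensorProduct.one_def, antipodeMul_tmul]

/-- `S(a₁) a₂ ⊗ a₃ = 1 ⊗ a`. -/
theorem sum_antipode_tmul_mul_comul (a : A) :
    ∑ i ∈ (ℛ k a).index, (antipode k ((ℛ k a).left i) ⊗ₜ[k] (1 : A)) *
      comul (R := k) ((ℛ k a).right i) = (1 : A) ⊗ₜ[k] a := by
  have h := Coalgebra.coassoc_apply (R := k) a
  -- F sends x ⊗ y ⊗ z to S(x) y ⊗ z; applying it to the two sides of coassociativity gives the two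
  -- sides of the claim.
  let F : A ⊗[k] (A ⊗[k] A) →ₗ[k] A ⊗[k] A :=
    (antipodeMul (k := k)).rTensor A ∘ₗ (TensorProduct.assoc k A A A).symm.toLinearMap
  have hF : ∀ (x : A) (W : A ⊗[k] A), F (x ⊗ₜ[k] W) = (antipode k x ⊗ₜ[k] (1 : A)) * W := by
    intro x W
    induction W with
    | zero => simp
    | add W W' h h' => simp only [TensorProduct.tmul_add, map_add, mul_add, h, h']
    | tmul y z => simp [F, antipodeMul_tmul]
  have h2 := congrArg F h
  have h3 : ∀ Z : (A ⊗[k] A) ⊗[k] A, F (TensorProduct.assoc k A A A Z) =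
      (antipodeMul (k := k)).rTensor A Z := by
    intro Z; simp [F]
  rw [h3] at h2
  have h4 : (antipodeMul (k := k)).rTensor A ((comul (R := k)).rTensor A (comul (R := k) a)) =
      (1 : A) ⊗ₜ[k] a := by
    rw [← LinearMap.comp_apply, ← LinearMap.rTensor_comp]
    have : antipodeMul (k := k) ∘ₗ (comul (R := k)) = (counit (R := k)).smulRight (1 : A) := by
      ext y
      exact antipodeMul_comul y
    rw [this, ← (ℛ k a).eq, map_sum]
    conv_rhs => rw [← sum_counit_smul (R := k) (ℛ k a), TensorProduct.tmul_sum]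
    refine Finset.sum_congr rfl fun i _ => ?_
    simp [TensorProduct.smul_tmul]
  rw [h4] at h2
  rw [h2]
  conv_rhs => rw [← (ℛ k a).eq, map_sum, map_sum]
  refine Finset.sum_congr rfl fun i _ => ?_
  rw [LinearMap.lTensor_tmul, hF]

/-- `Λ₁ ⊗ a Λ₂ = S(a) Λ₁ ⊗ Λ₂` for a left integral `Λ`. -/
theorem IsLeftIntegral.one_tmul_mul_comul {Λ : A} (hΛ : IsLeftIntegral k Λ) (a : A) :
    ((1 : A) ⊗ₜ[k] a) * comul (R := k) Λ = (antipode k a ⊗ₜ[k] (1 : A)) * comul (R := k) Λ := by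
  rw [← sum_antipode_tmul_mul_comul, Finset.sum_mul]
  conv_rhs => rw [← sum_counit_right_smul (k := k) a, map_sum, TensorProduct.sum_tmul, Finset.sum_mul]
  refine Finset.sum_congr rfl fun i _ => ?_
  rw [mul_assoc, ← Bialgebra.comul_mul, hΛ, map_smul, map_smul, mul_smul_comm,
    ← TensorProduct.smul_tmul', smul_mul_assoc]

/-- `f(x₁) x₂`. -/
def functionalComul (x : A) (f : Module.Dual k A) : A :=
  TensorProduct.lid k A (f.rTensor A (comul (R := k) x))

/-- Consequently the elements f(Λ₁) Λ₂ form a left ideal, with a acting through S(a) inside the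
functional. -/
theorem IsLeftIntegral.mul_functionalComul {Λ : A} (hΛ : IsLeftIntegral k Λ) (a : A)
    (f : Module.Dual k A) :
    a * functionalComul Λ f = functionalComul Λ (f ∘ₗ LinearMap.mulLeft k (antipode k a)) := by
  have h1 : ∀ W : A ⊗[k] A, a * TensorProduct.lid k A (f.rTensor A W) =
      TensorProduct.lid k A (f.rTensor A (((1 : A) ⊗ₜ[k] a) * W)) := by
    intro W
    induction W with
    | zero => simp
    | add W W' h h' => simp only [map_add, mul_add, h, h']
    | tmul x y => simp
  have h2 : ∀ W : A ⊗[k] A, TensorProduct.lid k A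
        ((f ∘ₗ LinearMap.mulLeft k (antipode k a)).rTensor A W) =
      TensorProduct.lid k A (f.rTensor A ((antipode k a ⊗ₜ[k] (1 : A)) * W)) := by
    intro W
    induction W with
    | zero => simp
    | add W W' h h' => simp only [map_add, mul_add, h, h']
    | tmul x y => simp
  rw [functionalComul, functionalComul, h1, h2, hΛ.one_tmul_mul_comul]

theorem functionalComul_counit (x : A) : functionalComul x (counit (R := k)) = x := by
  simp [functionalComul]

theorem functionalComul_sum {ι : Type*} (s : Finset ι) (x : A) (f : ι → Module.Dual k A) :
    functionalComul x (∑ i ∈ s, f i) = ∑ i ∈ s, functionalComul x (f i) := by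
  unfold functionalComul
  generalize comul (R := k) x = W
  induction W with
  | zero => simp
  | add W W' h h' => simp only [map_add, Finset.sum_add_distrib, h, h']
  | tmul y z => simp [LinearMap.sum_apply, Finset.sum_smul]

theorem functionalComul_smul (c : k) (x : A) (f : Module.Dual k A) :
    functionalComul x (c • f) = c • functionalComul x f := by
  simp [functionalComul, LinearMap.rTensor_smul]

/-- Expanding h(x₁) in a basis places h(x₁) x₂ in the left ideal generated by the elements f(x₁) x₂.
-/
theorem mul'_rTensor_eq_sum [FiniteDimensional k A] (h : A →ₗ[k] A) (x : A) :
    LinearMap.mul' k A (h.rTensor A (comul (R := k) x)) =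
      ∑ j, (Module.finBasis k A) j *
        functionalComul x ((Module.finBasis k A).coord j ∘ₗ h) := by
  unfold functionalComul
  generalize comul (R := k) x = W
  induction W with
  | zero => simp
  | add W W' h h' => simp only [map_add, mul_add, Finset.sum_add_distrib, h, h']
  | tmul y z =>
    simp only [LinearMap.rTensor_tmul, LinearMap.mul'_apply, TensorProduct.lid_tmul,
      LinearMap.comp_apply, mul_smul_comm, Module.Basis.coord_apply]
    conv_lhs => rw [← (Module.finBasis k A).sum_repr (h y), Finset.sum_mul]
    simp only [smul_mul_assoc]

/-- `S(x₁) x₂` for `x = f(Λ₁) Λ₂` is of the form `h(Λ₁) Λ₂`, with `h(y) = f(y₁) S(y₂)`. -/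
theorem antipodeMul_comul_functionalComul (x : A) (f : Module.Dual k A) :
    LinearMap.mul' k A ((antipode k ∘ₗ (TensorProduct.lid k A).toLinearMap ∘ₗ f.rTensor A ∘ₗ
      comul (R := k)).rTensor A (comul (R := k) x)) =
      antipodeMul (k := k) (comul (R := k) (functionalComul x f)) := by
  have h1 : ∀ Z : A ⊗[k] (A ⊗[k] A), LinearMap.mul' k A
        ((antipode k ∘ₗ (TensorProduct.lid k A).toLinearMap ∘ₗ f.rTensor A).rTensor A
          ((TensorProduct.assoc k A A A).symm Z)) =
      antipodeMul (k := k) (TensorProduct.lid k (A ⊗[k] A) (f.rTensor (A ⊗[k] A) Z)) := by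
    intro Z
    induction Z with
    | zero => simp
    | add Z Z' h h' => simp only [map_add, h, h']
    | tmul a W =>
      induction W with
      | zero => simp
      | add W W' h h' => simp only [TensorProduct.tmul_add, map_add, h, h']
      | tmul b c => simp [antipodeMul_tmul]
  have h2 : ∀ W : A ⊗[k] A, TensorProduct.lid k (A ⊗[k] A) (f.rTensor (A ⊗[k] A)
        ((comul (R := k)).lTensor A W)) =
      comul (R := k) (TensorProduct.lid k A (f.rTensor A W)) := by
    intro W
    induction W with
    | zero => simp
    | add W W' h h' => simp only [map_add, h, h']
    | tmul b c => simp
  rw [functionalComul, ← h2, ← h1, Coalgebra.coassoc_symm_apply,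
    ← LinearMap.comp_apply (LinearMap.rTensor A _) (LinearMap.rTensor A _),
    ← LinearMap.rTensor_comp]
  rfl

theorem counit_functionalComul (x : A) (f : Module.Dual k A) :
    counit (R := k) (functionalComul x f) = f x := by
  conv_rhs => rw [← counitRight_comul (k := k) x]
  unfold functionalComul
  generalize comul (R := k) x = W
  induction W with
  | zero => simp
  | add W W' h h' => simp only [map_add, h, h']
  | tmul y z => simp [counitRight_tmul, mul_comm]

/-- Choose f with f(Λ) = 1 and let x = f(Λ₁) Λ₂, so that ε(x) = 1. Then 1 = S(x₁) x₂ has the form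
h(Λ₁) Λ₂ with h valued in A, hence lies in the left ideal of all g(Λ₁) Λ₂. -/
theorem IsLeftIntegral.exists_functionalComul_eq_one [FiniteDimensional k A] {Λ : A}
    (hΛ : IsLeftIntegral k Λ) (hΛ0 : Λ ≠ 0) :
    ∃ g : Module.Dual k A, functionalComul Λ g = 1 := by
  obtain ⟨f, hf⟩ := Module.Projective.exists_dual_eq_one k hΛ0
  have h := antipodeMul_comul_functionalComul Λ f
  rw [antipodeMul_comul, counit_functionalComul, hf, one_smul, mul'_rTensor_eq_sum] at h
  simp only [hΛ.mul_functionalComul] at h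
  rw [← functionalComul_sum] at h
  exact ⟨_, h⟩

/-- Left integrals are unique up to scalars. -/
theorem IsLeftIntegral.exists_eq_smul [FiniteDimensional k A] {Λ : A}
    (hΛ : IsLeftIntegral k Λ) (hΛ0 : Λ ≠ 0) :
    ∃ g : Module.Dual k A, ∀ Λ' : A, IsLeftIntegral k Λ' → Λ' = g (antipode k Λ') • Λ := by
  obtain ⟨g, hg⟩ := hΛ.exists_functionalComul_eq_one hΛ0
  have key : ∀ a : A, a = functionalComul Λ (g ∘ₗ LinearMap.mulLeft k (antipode k a)) := by
    intro a
    rw [← hΛ.mul_functionalComul, hg, mul_one]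
  -- By `key`, a = g(S(a) Λ₁) Λ₂ depends on S(a) only. Finite dimension then makes S surjective as
  -- well.
  have hinj : Function.Injective (antipode k : A →ₗ[k] A) := by
    intro a b hab
    rw [key a, key b, hab]
  have hsurj := LinearMap.injective_iff_surjective.mp hinj
  refine ⟨g, fun Λ' hΛ' => ?_⟩
  -- With y = S(z), S(Λ') S(z) = S(z Λ') = ε(z) S(Λ') and ε(z) = ε(y). The formula for Λ' then
  -- reduces to a multiple of ε(Λ₁) Λ₂ = Λ.
  have h : g ∘ₗ LinearMap.mulLeft k (antipode k Λ') =
      g (antipode k Λ') • (counit (R := k) : A →ₗ[k] k) := by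
    ext y
    obtain ⟨z, rfl⟩ := hsurj y
    simp only [LinearMap.comp_apply, LinearMap.mulLeft_apply, LinearMap.smul_apply, smul_eq_mul,
      ← antipode_mul_antidistrib, hΛ' z, map_smul, counit_antipode]
    exact mul_comm _ _
  conv_lhs => rw [key Λ', h, functionalComul_smul, functionalComul_counit]

/-- The distinguished character of a nonzero left integral. -/
theorem IsLeftIntegral.existsUnique_char [FiniteDimensional k A] {Λ : A}
    (hΛ : IsLeftIntegral k Λ) (hΛ0 : Λ ≠ 0) :
    ∃! α : A →ₐ[k] k, ∀ a : A, Λ * a = α a • Λ := by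
  obtain ⟨g, hg⟩ := hΛ.exists_eq_smul hΛ0
  -- Each Λa is a left integral, and g(S(Λa)) is its coefficient with respect to Λ, which makes
  -- linearity in a automatic.
  let φ : A →ₗ[k] k := g ∘ₗ antipode k ∘ₗ LinearMap.mulLeft k Λ
  have hφ : ∀ a, Λ * a = φ a • Λ := fun a =>
    hg (Λ * a) fun b => by rw [← mul_assoc, hΛ, smul_mul_assoc]
  have hinj := smul_left_injective k hΛ0
  refine ⟨AlgHom.ofLinearMap φ ?_ ?_, hφ, fun β hβ => ?_⟩
  · exact hinj (by simp [← hφ])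
  · intro a b
    refine hinj ?_
    change φ (a * b) • Λ = (φ a * φ b) • Λ
    rw [← hφ, ← mul_assoc, hφ a, smul_mul_assoc, hφ b, smul_smul]
  · ext a
    exact hinj ((hβ a).symm.trans (hφ a))

theorem IsUnimodular.twistT_eq_one (hA : IsUnimodular k A) {Λ : A}
    (hΛ : IsLeftIntegral k Λ) (hΛ0 : Λ ≠ 0) {α : A →ₐ[k] k} (hα : ∀ a, Λ * a = α a • Λ)
    {J : (A ⊗[k] A)ˣ} (hJ : IsNormalizedTwist J) : twistT α J = 1 := by
  have h : α = Bialgebra.counitAlgHom k A := by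
    ext a
    exact smul_left_injective k hΛ0 ((hα a).symm.trans ((hA Λ).1 hΛ a))
  rw [h]
  -- For α = ε the element T is (id ⊗ ε)(J⁻¹), which is 1 by normalization.
  exact hJ.counitRight_inv

end IntegralUniqueness

end HopfTwist

end

theorem theorem3p3 {k : Type*} {A : Type*} [Field k] [Ring A] [HopfAlgebra k A]
    [FiniteDimensional k A] (Λ : A) (hΛ : HopfTwist.IsLeftIntegral k Λ) (hΛ0 : Λ ≠ 0) :
    (∃! α : A →ₐ[k] k, ∀ a : A, Λ * a = α a • Λ) ∧
    ∀ α : A →ₐ[k] k, (∀ a : A, Λ * a = α a • Λ) →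
      ∀ (J : (A ⊗[k] A)ˣ) (hJ : HopfTwist.IsNormalizedTwist J) (n : ℤ),
        HopfTwist.twistSweedlerPower J hJ n Λ =
          HopfTwist.twistT α J * HopfTwist.sweedlerPower k n Λ ∧
        HopfTwist.twistSweedlerPower J hJ n Λ =
          (((HopfTwist.twistQ J hJ)⁻¹ : Aˣ) : A) * HopfTwist.sweedlerPower k n Λ *
            HopfAlgebra.antipode k (HopfTwist.twistR α J) * (HopfTwist.twistQ J hJ : A) ∧
        (HopfTwist.IsUnimodular k A →
          HopfTwist.twistSweedlerPower J hJ n Λ = HopfTwist.sweedlerPower k n Λ) := by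
  refine ⟨hΛ.existsUnique_char hΛ0, fun α hα J hJ n =>
    ⟨HopfTwist.twistSweedlerPower_integral_eq_twistT_mul hΛ hα hJ n,
      HopfTwist.twistSweedlerPower_integral_eq_mul_twistR hΛ hα hJ n, fun hA => ?_⟩⟩
  rw [HopfTwist.twistSweedlerPower_integral_eq_twistT_mul hΛ hα hJ n,
    hA.twistT_eq_one hΛ hΛ0 hα hJ, one_mul]
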